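/- Let $M$ be a smooth finite-dimensional manifold without boundary, with tangent bundle $\pi:TM\to M$. An almost product structure on a manifold is a smooth $(1,1)$-tensor field $P\neq\pm\mathrm{Id}$ with $P^2=\mathrm{Id}$; an almost complex structure is a smooth $(1,1)$-tensor field $J$ with $J^2=-\mathrm{Id}$; a semi-Riemannian metric is a smooth field of nondegenerate symmetric bilinear forms on the tangent spaces. An almost para-hermitian manifold $(M,P,g)$ is a manifold $M$ with an almost product structure $P$ and a semi-Riemannian metric $g$ such that $g(PX,PY)=-g(X,Y)$ for all $X,Y$. An almost para-hypercomplex structure is a triple $(J_1,J_2,J_3)$, where $J_1$ is an almost complex structure and $J_2,J_3$ are almost product structures, with $J_2J_1=-J_1J_2=J_3$. A semi-Riemannian metric $G$ is para-hyperhermitian with respect to it if $G(J_\alpha X,J_\alpha Y)=\epsilon_\alpha G(X,Y)$ for all $X,Y$ and $\alpha=1,2,3$, where $\epsilon_1=1$, $\epsilon_2=\epsilon_3=-1$. For a semi-Riemannian metric $g$ on $M$, let $K:T_t(TM)\to T_{\pi(t)}M$ ($t\in TM$) be the connection map of the Levi-Civita connection of $g$; in the coordinates $(x,y)$ of $TM$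 induced by coordinates $x$ of $M$ it is $K(A)^i=dy^i(A)+\Gamma^i_{jk}(x)\,dx^j(A)\,y^k$. The Sasaki metric on $TM$ is $G(A,B)=g(KA,KB)+g(\pi_*A,\pi_*B)$. The horizontal and vertical lifts of a vector field $X$ on $M$ are the vector fields $X^h,X^v$ on $TM$ determined by $\pi_*X^h_t=X_{\pi(t)}$, $KX^h_t=0$ and $\pi_*X^v_t=0$, $KX^v_t=X_{\pi(t)}$ for all $t\in TM$. Theorem. Let $(M,P,g)$ be an almost para-hermitian manifold. Then there is an almost para-hypercomplex structure $(J_1,J_2,J_3)$ on $TM$ with $$J_1X^h=X^v,\quad J_1X^v=-X^h,\qquad J_2X^h=(PX)^v,\quad J_2X^v=(PX)^h,\qquad J_3X^h=(PX)^h,\quad J_3X^v=-(PX)^v$$ for all vector fields $X$ on $M$, and the Sasaki metric $G$ is a semi-Riemannian metric on $TM$ that is para-hyperhermitian with respect to $(J_1,J_2,J_3)$. -/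

import Mathlib

open scoped Manifold ContDiff Bundle

noncomputable section

namespace ParaHyperhermitian

section General

variable {E : Type*} [NormedAddCommGroup E] [NormedSpace ℝ E]
  {H : Type*} [TopologicalSpace H] (I : ModelWithCorners ℝ E H)
  {M : Type*} [TopologicalSpace M] [ChartedSpace H M] [IsManifold I ∞ M]

/-- A field of endomorphisms of the tangent spaces is a (smooth) tensor field of type `(1,1)` if
it is a smooth section of the bundle `End(TM)`. -/
def IsTensorField11 (A : ∀ x : M, TangentSpace I x →L[ℝ] TangentSpace I x) : Prop :=
  ContMDiff I (I.prod 𝓘(ℝ, E →L[ℝ] E)) ∞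
    (fun x ↦ Bundle.TotalSpace.mk' (E →L[ℝ] E)
      (E := fun x : M ↦ TangentSpace I x →L[ℝ] TangentSpace I x) x (A x))

/-- A semi-Riemannian metric: a smooth field of nondegenerate symmetric bilinear forms on the
tangent spaces. -/
structure IsSemiRiemannianMetric
    (g : ∀ x : M, TangentSpace I x →L[ℝ] TangentSpace I x →L[ℝ] ℝ) : Prop where
  smooth : ContMDiff I (I.prod 𝓘(ℝ, E →L[ℝ] E →L[ℝ] ℝ)) ∞
    (fun x ↦ Bundle.TotalSpace.mk' (E →L[ℝ] E →L[ℝ] ℝ)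
      (E := fun x : M ↦ TangentSpace I x →L[ℝ] TangentSpace I x →L[ℝ] ℝ) x (g x))
  symm : ∀ (x : M) (v w : TangentSpace I x), g x v w = g x w v
  nondegenerate : ∀ (x : M) (v : TangentSpace I x), (∀ w, g x v w = 0) → v = 0

/-- An almost product structure: a tensor field `P ≠ ± Id` of type `(1,1)` with `P² = Id`. -/
structure IsAlmostProduct (P : ∀ x : M, TangentSpace I x →L[ℝ] TangentSpace I x) : Prop where
  smooth : IsTensorField11 I P
  ne_id : P ≠ fun x ↦ ContinuousLinearMap.id ℝ (TangentSpace I x)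
  ne_neg_id : P ≠ fun x ↦ -ContinuousLinearMap.id ℝ (TangentSpace I x)
  sq : ∀ (x : M) (v : TangentSpace I x), P x (P x v) = v

/-- An almost complex structure: a tensor field `J` of type `(1,1)` with `J² = -Id`. -/
structure IsAlmostComplex (J : ∀ x : M, TangentSpace I x →L[ℝ] TangentSpace I x) : Prop where
  smooth : IsTensorField11 I J
  sq : ∀ (x : M) (v : TangentSpace I x), J x (J x v) = -v

/-- An almost para-hermitian structure `(P, g)`. -/
structure IsAlmostParaHermitian (P : ∀ x : M, TangentSpace I x →L[ℝ] TangentSpace I x)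
    (g : ∀ x : M, TangentSpace I x →L[ℝ] TangentSpace I x →L[ℝ] ℝ) : Prop where
  product : IsAlmostProduct I P
  metric : IsSemiRiemannianMetric I g
  compat : ∀ (x : M) (v w : TangentSpace I x), g x (P x v) (P x w) = -g x v w

/-- An almost para-hypercomplex structure `(J₁, J₂, J₃)`. -/
structure IsAlmostParaHypercomplex
    (J₁ J₂ J₃ : ∀ x : M, TangentSpace I x →L[ℝ] TangentSpace I x) : Prop where
  complex₁ : IsAlmostComplex I J₁
  product₂ : IsAlmostProduct I J₂
  product₃ : IsAlmostProduct I J₃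
  mul₂₁ : ∀ (x : M) (v : TangentSpace I x), J₂ x (J₁ x v) = J₃ x v
  mul₁₂ : ∀ (x : M) (v : TangentSpace I x), -J₁ x (J₂ x v) = J₃ x v

/-- A semi-Riemannian metric `g` that is para-hyperhermitian for the triple `(J₁, J₂, J₃)`. -/
structure IsParaHyperhermitian
    (J₁ J₂ J₃ : ∀ x : M, TangentSpace I x →L[ℝ] TangentSpace I x)
    (g : ∀ x : M, TangentSpace I x →L[ℝ] TangentSpace I x →L[ℝ] ℝ) : Prop where
  metric : IsSemiRiemannianMetric I g
  compat₁ : ∀ (x : M) (v w : TangentSpace I x), g x (J₁ x v) (J₁ x w) = g x v w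
  compat₂ : ∀ (x : M) (v w : TangentSpace I x), g x (J₂ x v) (J₂ x w) = -g x v w
  compat₃ : ∀ (x : M) (v w : TangentSpace I x), g x (J₃ x v) (J₃ x w) = -g x v w

end General

/-- The pullback `(v, w) ↦ B (T v) (T w)` of a bilinear form `B` by a linear map `T`. -/
def pullbackForm {V W : Type*} [AddCommGroup V] [Module ℝ V] [TopologicalSpace V]
    [IsTopologicalAddGroup V] [ContinuousSMul ℝ V] [AddCommGroup W] [Module ℝ W]
    [TopologicalSpace W] [IsTopologicalAddGroup W] [ContinuousSMul ℝ W]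
    (B : V →L[ℝ] V →L[ℝ] ℝ) (T : W →L[ℝ] V) : W →L[ℝ] W →L[ℝ] ℝ :=
  ContinuousLinearMap.precomp ℝ T ∘L B ∘L T

theorem pullbackForm_apply {V W : Type*} [AddCommGroup V] [Module ℝ V] [TopologicalSpace V]
    [IsTopologicalAddGroup V] [ContinuousSMul ℝ V] [AddCommGroup W] [Module ℝ W]
    [TopologicalSpace W] [IsTopologicalAddGroup W] [ContinuousSMul ℝ W]
    (B : V →L[ℝ] V →L[ℝ] ℝ) (T : W →L[ℝ] V) (v w : W) :
    pullbackForm B T v w = B (T v) (T w) := rfl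

set_option synthInstance.maxHeartbeats 100000 in
/-- The Christoffel symbols at the point `z` of `E` of the Levi-Civita connection of the metric
with coefficients `G(z) = (gᵢⱼ(z))`: `christoffel G z v u` is the vector
`Γ(u, v) = (Γⁱⱼₖ uʲ vᵏ)ᵢ` with
`2 G(Γ(u, v), w) = (∂_u G)(v, w) + (∂_v G)(u, w) - (∂_w G)(v, u)` for all `w`. The inverse matrix
`(gⁱʲ)` enters as the inverse of the map `E → E*` given by `G(z)`. -/
def christoffel {E : Type*} [NormedAddCommGroup E] [NormedSpace ℝ E]
    (G : E → E →L[ℝ] E →L[ℝ] ℝ) (z v : E) : E →L[ℝ] E :=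
  let D : E →L[ℝ] E →L[ℝ] E →L[ℝ] ℝ := fderiv ℝ G z
  (G z).inverse ∘L ((2⁻¹ : ℝ) • (D.flip v + D v - (D.flip v).flip))

set_option synthInstance.maxHeartbeats 100000 in
theorem christoffel_spec {E : Type*} [NormedAddCommGroup E] [NormedSpace ℝ E]
    (G : E → E →L[ℝ] E →L[ℝ] ℝ) (z u v w : E) (h : (G z).IsInvertible) :
    2 * G z (christoffel G z v u) w =
      fderiv ℝ G z u v w + fderiv ℝ G z v u w - fderiv ℝ G z w v u := by
  obtain ⟨e, he⟩ := h
  simp only [christoffel, ← he, ContinuousLinearMap.inverse_equiv]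
  simp

section Sasaki

variable {E : Type*} [NormedAddCommGroup E] [NormedSpace ℝ E]
  {M : Type*} [TopologicalSpace M] [ChartedSpace E M] [IsManifold 𝓘(ℝ, E) ∞ M]

/-- The coordinate isomorphism `T_pM → E` of the chart at `x₀` (the differential at `p` of that
chart), for `p` in the domain of the chart. -/
def toCoord (x₀ p : M) : TangentSpace 𝓘(ℝ, E) p →L[ℝ] E :=
  (trivializationAt E (TangentSpace 𝓘(ℝ, E)) x₀).continuousLinearMapAt ℝ p

/-- The inverse coordinate isomorphism `E → T_pM` of the chart at `x₀`; it sends the standard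
vectors to the coordinate vectors `∂ᵢ` at `p`. -/
def ofCoord (x₀ p : M) : E →L[ℝ] TangentSpace 𝓘(ℝ, E) p :=
  (trivializationAt E (TangentSpace 𝓘(ℝ, E)) x₀).symmL ℝ p

/-- The coefficients `z ↦ (gᵢⱼ(z))` of the metric in the chart at `x₀`, as a bilinear form on `E`
depending on the point `z` of the range of the chart. -/
def metricInChart (g : ∀ x : M, TangentSpace 𝓘(ℝ, E) x →L[ℝ] TangentSpace 𝓘(ℝ, E) x →L[ℝ] ℝ)
    (x₀ : M) (z : E) : E →L[ℝ] E →L[ℝ] ℝ :=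
  pullbackForm (g ((chartAt E x₀).symm z)) (ofCoord x₀ ((chartAt E x₀).symm z))

/-- The differential `π_* : T_t(TM) → T_{π(t)}M` of the projection `π : TM → M`. -/
def projDiff (t : TangentBundle 𝓘(ℝ, E) M) :
    TangentSpace 𝓘(ℝ, E).tangent t →L[ℝ] TangentSpace 𝓘(ℝ, E) t.proj :=
  mfderiv 𝓘(ℝ, E).tangent 𝓘(ℝ, E) (fun s : TangentBundle 𝓘(ℝ, E) M ↦ s.proj) t

/-- The fibre coordinate `y : TM → E` of the chart of `TM` induced by the chart of `M` at `x₀`. -/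
def fibreCoord (x₀ : M) (s : TangentBundle 𝓘(ℝ, E) M) : E :=
  (trivializationAt E (TangentSpace 𝓘(ℝ, E)) x₀ s).2

/-- The connection map `K : T_t(TM) → T_{π(t)}M` of the Levi-Civita connection of `g`. In the
chart of `M` at `π(t)` and the induced chart `(x, y)` of `TM`,
`K(A) = dy(A) + Γ(dx(A), y(t))`. -/
def connectionMap (g : ∀ x : M, TangentSpace 𝓘(ℝ, E) x →L[ℝ] TangentSpace 𝓘(ℝ, E) x →L[ℝ] ℝ)
    (t : TangentBundle 𝓘(ℝ, E) M) :
    TangentSpace 𝓘(ℝ, E).tangent t →L[ℝ] TangentSpace 𝓘(ℝ, E) t.proj :=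
  ofCoord t.proj t.proj ∘L
    (mvfderiv 𝓘(ℝ, E).tangent (fibreCoord t.proj) t +
      christoffel (metricInChart g t.proj) (chartAt E t.proj t.proj) (fibreCoord t.proj t) ∘L toCoord t.proj t.proj ∘L projDiff t)

/-- The Sasaki metric `G(A, B) = g(K A, K B) + g(π_* A, π_* B)` on `TM`. -/
def sasakiMetric (g : ∀ x : M, TangentSpace 𝓘(ℝ, E) x →L[ℝ] TangentSpace 𝓘(ℝ, E) x →L[ℝ] ℝ)
    (t : TangentBundle 𝓘(ℝ, E) M) :
    TangentSpace 𝓘(ℝ, E).tangent t →L[ℝ] TangentSpace 𝓘(ℝ, E).tangent t →L[ℝ] ℝ :=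
  pullbackForm (g t.proj) (connectionMap g t) + pullbackForm (g t.proj) (projDiff t)

theorem sasakiMetric_apply
    (g : ∀ x : M, TangentSpace 𝓘(ℝ, E) x →L[ℝ] TangentSpace 𝓘(ℝ, E) x →L[ℝ] ℝ)
    (t : TangentBundle 𝓘(ℝ, E) M) (A B : TangentSpace 𝓘(ℝ, E).tangent t) :
    sasakiMetric g t A B =
      g t.proj (connectionMap g t A) (connectionMap g t B) +
        g t.proj (projDiff t A) (projDiff t B) := rfl

theorem fibreCoord_mvfderiv_self (t : TangentBundle 𝓘(ℝ, E) M) (A : E × E) :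
    mvfderiv 𝓘(ℝ, E).tangent (fibreCoord t.proj) t A = A.2 := by
  have h0 : HasMFDerivAt 𝓘(ℝ, E).tangent 𝓘(ℝ, E × E) (extChartAt 𝓘(ℝ, E).tangent t) t
      (ContinuousLinearMap.id ℝ (E × E)) := by
    have := (mdifferentiableAt_extChartAt (I := 𝓘(ℝ, E).tangent)
      (mem_chart_source (ModelProd E E) t)).hasMFDerivAt
    rwa [mfderiv_extChartAt_self] at this
  have h1 : HasMFDerivAt 𝓘(ℝ, E).tangent 𝓘(ℝ, E)
      (Prod.snd ∘ extChartAt 𝓘(ℝ, E).tangent t) t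
      ((ContinuousLinearMap.snd ℝ E E).comp (ContinuousLinearMap.id ℝ (E × E))) :=
    HasMFDerivAt.comp t (ContinuousLinearMap.hasMFDerivAt (ContinuousLinearMap.snd ℝ E E)) h0
  have h2 : HasMFDerivAt 𝓘(ℝ, E).tangent 𝓘(ℝ, E) (fibreCoord t.proj) t
      ((ContinuousLinearMap.snd ℝ E E).comp (ContinuousLinearMap.id ℝ (E × E))) :=
    h1.congr_of_eventuallyEq (Filter.Eventually.of_forall fun s ↦ rfl)
  simp only [mvfderiv, h2.mfderiv]
  rfl

theorem projDiff_apply (t : TangentBundle 𝓘(ℝ, E) M) (A : E × E) : projDiff t A = A.1 := by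
  have h0 : HasMFDerivAt 𝓘(ℝ, E).tangent 𝓘(ℝ, E × E) (extChartAt 𝓘(ℝ, E).tangent t) t
      (ContinuousLinearMap.id ℝ (E × E)) := by
    have := (mdifferentiableAt_extChartAt (I := 𝓘(ℝ, E).tangent)
      (mem_chart_source (ModelProd E E) t)).hasMFDerivAt
    rwa [mfderiv_extChartAt_self] at this
  have h1 : HasMFDerivAt 𝓘(ℝ, E).tangent 𝓘(ℝ, E)
      (Prod.fst ∘ extChartAt 𝓘(ℝ, E).tangent t) t
      ((ContinuousLinearMap.fst ℝ E E).comp (ContinuousLinearMap.id ℝ (E × E))) :=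
    HasMFDerivAt.comp t (ContinuousLinearMap.hasMFDerivAt (ContinuousLinearMap.fst ℝ E E)) h0
  have h2 : MDifferentiableAt 𝓘(ℝ, E).tangent 𝓘(ℝ, E)
      (fun s : TangentBundle 𝓘(ℝ, E) M ↦ s.proj) t :=
    (Bundle.contMDiff_proj (n := 1) (TangentSpace 𝓘(ℝ, E) (M := M))).mdifferentiableAt one_ne_zero
  have h3 : HasMFDerivAt 𝓘(ℝ, E) 𝓘(ℝ, E) (extChartAt 𝓘(ℝ, E) t.proj) t.proj
      (ContinuousLinearMap.id ℝ E) := by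
    have := (mdifferentiableAt_extChartAt (I := 𝓘(ℝ, E))
      (mem_chart_source E t.proj)).hasMFDerivAt
    rwa [mfderiv_extChartAt_self] at this
  have h4 := HasMFDerivAt.comp t h3 h2.hasMFDerivAt
  have h5 : HasMFDerivAt 𝓘(ℝ, E).tangent 𝓘(ℝ, E)
      (extChartAt 𝓘(ℝ, E) t.proj ∘ fun s : TangentBundle 𝓘(ℝ, E) M ↦ s.proj) t
      ((ContinuousLinearMap.fst ℝ E E).comp (ContinuousLinearMap.id ℝ (E × E))) := by
    exact h1.congr_of_eventuallyEq (Filter.Eventually.of_forall fun s ↦ rfl)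
  exact congr($(hasMFDerivAt_unique h4 h5) A)

theorem ofCoord_self (x : M) (v : E) : ofCoord x x v = v := by
  unfold ofCoord
  rw [TangentBundle.symmL_trivializationAt_eq_core (mem_chart_source E x)]
  exact (tangentBundleCore 𝓘(ℝ, E) M).coordChange_self (achart E x) x (mem_chart_source E x) v

/-- The map `(π_*, K) : T_t(TM) → T_{π(t)}M × T_{π(t)}M` is bijective. -/
theorem bijective_projDiff_connectionMap
    (g : ∀ x : M, TangentSpace 𝓘(ℝ, E) x →L[ℝ] TangentSpace 𝓘(ℝ, E) x →L[ℝ] ℝ)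
    (t : TangentBundle 𝓘(ℝ, E) M) :
    Function.Bijective (fun A : TangentSpace 𝓘(ℝ, E).tangent t ↦
      (projDiff t A, connectionMap g t A)) := by
  obtain ⟨C, hC⟩ : ∃ C : E →L[ℝ] E, ∀ A : E × E, connectionMap g t A = A.2 + C A.1 := by
    refine ⟨christoffel (metricInChart g t.proj) (chartAt E t.proj t.proj)
      (fibreCoord t.proj t) ∘L toCoord t.proj t.proj, fun A ↦ ?_⟩
    refine (ofCoord_self t.proj _).trans ?_
    exact congr($(fibreCoord_mvfderiv_self t A) + christoffel (metricInChart g t.proj)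
      (chartAt E t.proj t.proj) (fibreCoord t.proj t) (toCoord t.proj t.proj $(projDiff_apply t A)))
  constructor
  · intro A B h
    have h1 : A.1 = B.1 := by
      have := congrArg Prod.fst h
      exact (projDiff_apply t A).symm.trans (this.trans (projDiff_apply t B))
    have h2 : A.2 + C A.1 = B.2 + C B.1 :=
      (hC A).symm.trans ((congrArg Prod.snd h).trans (hC B))
    rw [h1] at h2
    exact Prod.ext h1 (add_right_cancel h2)
  · rintro ⟨v, w⟩
    have key : ∀ v w : E, (projDiff t ((v, w - C v) : E × E), connectionMap g t
        ((v, w - C v) : E × E)) = ((v, w) : E × E) := fun v w ↦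
      Prod.ext (projDiff_apply t _) ((hC _).trans (sub_add_cancel w (C v)))
    exact ⟨_, key v w⟩

/-- Every pair `(v, w)` of tangent vectors at `π(t)` is `(π_* A, K A)` for exactly one
`A ∈ T_t(TM)`. -/
theorem existsUnique_lift
    (g : ∀ x : M, TangentSpace 𝓘(ℝ, E) x →L[ℝ] TangentSpace 𝓘(ℝ, E) x →L[ℝ] ℝ)
    (t : TangentBundle 𝓘(ℝ, E) M) (v w : TangentSpace 𝓘(ℝ, E) t.proj) :
    ∃! A : TangentSpace 𝓘(ℝ, E).tangent t, projDiff t A = v ∧ connectionMap g t A = w := by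
  simpa only [Prod.mk.injEq] using (bijective_projDiff_connectionMap g t).existsUnique (v, w)

/-- The horizontal lift `Xʰ` of a vector field `X` on `M`: the vector field on `TM` determined by
`π_* Xʰ = X` and `K Xʰ = 0`. -/
def horizontalLift (g : ∀ x : M, TangentSpace 𝓘(ℝ, E) x →L[ℝ] TangentSpace 𝓘(ℝ, E) x →L[ℝ] ℝ)
    (X : ∀ x : M, TangentSpace 𝓘(ℝ, E) x) (t : TangentBundle 𝓘(ℝ, E) M) :
    TangentSpace 𝓘(ℝ, E).tangent t :=
  (existsUnique_lift g t (X t.proj) 0).choose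

/-- The vertical lift `Xᵛ` of a vector field `X` on `M`: the vector field on `TM` determined by
`π_* Xᵛ = 0` and `K Xᵛ = X`. -/
def verticalLift (g : ∀ x : M, TangentSpace 𝓘(ℝ, E) x →L[ℝ] TangentSpace 𝓘(ℝ, E) x →L[ℝ] ℝ)
    (X : ∀ x : M, TangentSpace 𝓘(ℝ, E) x) (t : TangentBundle 𝓘(ℝ, E) M) :
    TangentSpace 𝓘(ℝ, E).tangent t :=
  (existsUnique_lift g t 0 (X t.proj)).choose

theorem horizontalLift_spec
    (g : ∀ x : M, TangentSpace 𝓘(ℝ, E) x →L[ℝ] TangentSpace 𝓘(ℝ, E) x →L[ℝ] ℝ)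
    (X : ∀ x : M, TangentSpace 𝓘(ℝ, E) x) (t : TangentBundle 𝓘(ℝ, E) M) :
    projDiff t (horizontalLift g X t) = X t.proj ∧
      connectionMap g t (horizontalLift g X t) = 0 :=
  (existsUnique_lift g t (X t.proj) 0).choose_spec.1

theorem verticalLift_spec
    (g : ∀ x : M, TangentSpace 𝓘(ℝ, E) x →L[ℝ] TangentSpace 𝓘(ℝ, E) x →L[ℝ] ℝ)
    (X : ∀ x : M, TangentSpace 𝓘(ℝ, E) x) (t : TangentBundle 𝓘(ℝ, E) M) :
    projDiff t (verticalLift g X t) = 0 ∧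
      connectionMap g t (verticalLift g X t) = X t.proj :=
  (existsUnique_lift g t 0 (X t.proj)).choose_spec.1

end Sasaki

end ParaHyperhermitian

end

/-! At each t in TM the pair (π_*, K) identifies T_t(TM) with two copies of T_{π(t)}M, the first
carrying the horizontal and the second the vertical vectors. In this splitting the prescribed values
say that J₁, J₂, J₃ are the block matrices ((0, -1), (1, 0)), ((0, P), (P, 0)), ((P, 0), (0, -P)),
and the Sasaki metric is g ⊕ g. The algebraic claims then follow block by block from P² = 1, the
symmetry and nondegeneracy of g, and g(PX, PY) = -g(X, Y); `ext_projDiff_connectionMap` reduces each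
equation between vectors to its two components.

The substance is smoothness. K at t is defined through the chart centred at π(t), which moves with
t, so smooth dependence on t is not visible. `connectionMap_symmL` shows that K has the same
expression dy + Γ(dx, y) in one fixed chart: the second derivative of the transition map, which
enters the tangent coordinates of TM (`symmL_tangentBundle`), is exactly the inhomogeneous term in
the transformation law of Γ (`christoffel_pullback`). In the fixed chart (π_*, K) becomes a shear
(a, b) ↦ (a, b + Ca) with C smooth in t. Each J is therefore a smooth block matrix conjugated by a
smooth shear (`blockEndo_symmL`), and the Sasaki metric is likewise a smooth expression in g and C.
-/

noncomputable section

namespace ParaHyperhermitian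

/-! ### Christoffel symbols on a vector space: change of variables and smoothness -/

section Calculus

variable {E : Type*} [NormedAddCommGroup E] [NormedSpace ℝ E]

/-- A shortcut for instance search. -/
instance normedAddCommGroupHom {V W : Type*} [NormedAddCommGroup V] [NormedSpace ℝ V]
    [NormedAddCommGroup W] [NormedSpace ℝ W] : NormedAddCommGroup (V →L[ℝ] W) :=
  ContinuousLinearMap.toNormedAddCommGroup

/-- A shortcut for instance search. -/
instance normedSpaceHom {V W : Type*} [NormedAddCommGroup V] [NormedSpace ℝ V]
    [NormedAddCommGroup W] [NormedSpace ℝ W] : NormedSpace ℝ (V →L[ℝ] W) :=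
  ContinuousLinearMap.toNormedSpace

/-- Nondegeneracy is injectivity of E → E*, and the two spaces have the same finite dimension. -/
theorem isInvertible_of_nondegenerate [FiniteDimensional ℝ E] {B : E →L[ℝ] E →L[ℝ] ℝ}
    (hB : ∀ v, (∀ w, B v w = 0) → v = 0) : B.IsInvertible := by
  have hinj : Function.Injective B := by
    rw [injective_iff_map_eq_zero]
    intro v hv
    exact hB v fun w ↦ by rw [hv]; rfl
  have hdim : Module.finrank ℝ E = Module.finrank ℝ (E →L[ℝ] ℝ) := by
    rw [← (LinearMap.toContinuousLinearMap : (E →ₗ[ℝ] ℝ) ≃ₗ[ℝ] E →L[ℝ] ℝ).finrank_eq]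
    exact (Subspace.dual_finrank_eq (K := ℝ) (V := E)).symm
  let e := LinearEquiv.ofInjectiveOfFinrankEq (B : E →ₗ[ℝ] E →L[ℝ] ℝ) hinj hdim
  exact ⟨e.toContinuousLinearEquiv, by ext; rfl⟩

theorem contDiffAt_pullbackForm {V W X : Type*} [NormedAddCommGroup V] [NormedSpace ℝ V]
    [NormedAddCommGroup W] [NormedSpace ℝ W] [NormedAddCommGroup X] [NormedSpace ℝ X]
    {n : WithTop ℕ∞} {B : X → V →L[ℝ] V →L[ℝ] ℝ} {T : X → W →L[ℝ] V} {x : X}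
    (hB : ContDiffAt ℝ n B x) (hT : ContDiffAt ℝ n T x) :
    ContDiffAt ℝ n (fun y ↦ pullbackForm (B y) (T y)) x := by
  have h : ContDiffAt ℝ n
      (fun y ↦ (ContinuousLinearMap.precomp ℝ (T y) : (V →L[ℝ] ℝ) →L[ℝ] W →L[ℝ] ℝ)) x :=
    (ContinuousLinearMap.compL ℝ W V ℝ).flip.contDiff.contDiffAt.comp x hT
  exact h.clm_comp (hB.clm_comp hT)

theorem contDiffAt_flip {U V W X : Type*} [NormedAddCommGroup U] [NormedSpace ℝ U]
    [NormedAddCommGroup V] [NormedSpace ℝ V]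
    [NormedAddCommGroup W] [NormedSpace ℝ W] [NormedAddCommGroup X] [NormedSpace ℝ X]
    {n : WithTop ℕ∞} {f : X → U →L[ℝ] V →L[ℝ] W} {x : X} (hf : ContDiffAt ℝ n f x) :
    ContDiffAt ℝ n (fun y ↦ (f y).flip) x :=
  (ContinuousLinearMap.flipₗᵢ ℝ U V W).contDiff.contDiffAt.comp x hf

set_option synthInstance.maxHeartbeats 100000 in
/-- The derivative of the pullback of a field of bilinear forms under a smooth map. -/
theorem fderiv_pullback_apply {φ : E → E} {G G' : E → E →L[ℝ] E →L[ℝ] ℝ} {z : E}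
    (hφ : ContDiffAt ℝ 2 φ z) (hG' : ContDiffAt ℝ 1 G' (φ z))
    (hG : ∀ᶠ x in nhds z, G x = pullbackForm (G' (φ x)) (fderiv ℝ φ x)) (u v w : E) :
    fderiv ℝ G z u v w =
      fderiv ℝ G' (φ z) (fderiv ℝ φ z u) (fderiv ℝ φ z v) (fderiv ℝ φ z w) +
        G' (φ z) (fderiv ℝ (fderiv ℝ φ) z u v) (fderiv ℝ φ z w) +
        G' (φ z) (fderiv ℝ φ z v) (fderiv ℝ (fderiv ℝ φ) z u w) := by
  have hφ1 : HasFDerivAt φ (fderiv ℝ φ z) z := (hφ.differentiableAt two_ne_zero).hasFDerivAt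
  have hφ2 : HasFDerivAt (fderiv ℝ φ) (fderiv ℝ (fderiv ℝ φ) z) z :=
    ((hφ.fderiv_right (m := 1) le_rfl).differentiableAt one_ne_zero).hasFDerivAt
  have hGd : DifferentiableAt ℝ G z :=
    ((contDiffAt_pullbackForm (hG'.comp z (hφ.of_le one_le_two))
      (hφ.fderiv_right (m := 1) le_rfl)).differentiableAt one_ne_zero).congr_of_eventuallyEq hG
  have hG'd : HasFDerivAt G' (fderiv ℝ G' (φ z)) (φ z) :=
    (hG'.differentiableAt one_ne_zero).hasFDerivAt
  -- With v and w frozen, the scalar function x ↦ G x v w is differentiated twice over: directly,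
  -- and by the product rule on the pullback formula. Uniqueness of the derivative gives the
  -- identity.
  have h1 : HasFDerivAt (fun x ↦ G x v w) ((fderiv ℝ G z).flip v |>.flip w) z := by
    have := (hGd.hasFDerivAt.clm_apply (hasFDerivAt_const v z)).clm_apply (hasFDerivAt_const w z)
    convert! this using 1
    ext; simp
  have h2 := ((hG'd.comp z hφ1).clm_apply
    (hφ2.clm_apply (hasFDerivAt_const v z))).clm_apply (hφ2.clm_apply (hasFDerivAt_const w z))
  have h3 := h2.congr_of_eventuallyEq (f₁ := fun x ↦ G x v w) (hG.mono fun x hx ↦ by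
    simp only [hx, pullbackForm_apply]; rfl)
  have h4 := congr($(h1.unique h3) u)
  simp at h4
  rw [h4]
  ring

set_option synthInstance.maxHeartbeats 100000 in
/-- The transformation law of the Christoffel symbols under a change of coordinates. -/
theorem christoffel_pullback {φ : E → E} {G G' : E → E →L[ℝ] E →L[ℝ] ℝ} {z : E}
    (hφ : ContDiffAt ℝ 2 φ z) (hG' : ContDiffAt ℝ 1 G' (φ z))
    (hG : ∀ᶠ x in nhds z, G x = pullbackForm (G' (φ x)) (fderiv ℝ φ x))
    (hinv : (G z).IsInvertible) (hinv' : (G' (φ z)).IsInvertible)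
    (hsymm : ∀ v w, G' (φ z) v w = G' (φ z) w v)
    (hsurj : Function.Surjective (fderiv ℝ φ z)) (u v : E) :
    fderiv ℝ φ z (christoffel G z v u) =
      christoffel G' (φ z) (fderiv ℝ φ z v) (fderiv ℝ φ z u) + fderiv ℝ (fderiv ℝ φ) z u v := by
  have hs : ∀ a b, fderiv ℝ (fderiv ℝ φ) z a b = fderiv ℝ (fderiv ℝ φ) z b a := fun a b ↦
    (hφ.isSymmSndFDerivAt (by simp)) a b
  -- By nondegeneracy of G' it suffices to pair both sides with test vectors, each of which is Dφ(w)
  -- for some w.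
  refine hinv'.injective (ContinuousLinearMap.ext fun w' ↦ ?_)
  obtain ⟨w, rfl⟩ := hsurj w'
  have h1 := christoffel_spec G z u v w hinv
  rw [hG.self_of_nhds, pullbackForm_apply] at h1
  simp only [fderiv_pullback_apply hφ hG' hG] at h1
  have h2 := christoffel_spec G' (φ z) (fderiv ℝ φ z u) (fderiv ℝ φ z v) (fderiv ℝ φ z w) hinv'
  rw [map_add, add_apply]
  -- Once D²φ and G' are symmetrized, the second-derivative terms of the Koszul formula cancel
  -- except for 2 G'(D²φ(u, v), Dφ w).
  rw [hs v u, hs w v, hs w u, hsymm (fderiv ℝ φ z u)] at h1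
  linarith

theorem contDiffAt_fderiv_apply {W : Type*} [NormedAddCommGroup W] [NormedSpace ℝ W]
    {f : E → W} {z : E} (hf : ContDiffAt ℝ ∞ f z) (v : E) :
    ContDiffAt ℝ ∞ (fun q : E × E ↦ fderiv ℝ f q.1 q.2) (z, v) :=
  ((hf.fderiv_right (m := ∞) le_rfl).comp (z, v) contDiffAt_fst).clm_apply contDiffAt_snd

theorem contDiffAt_fderiv_flip_apply {V W : Type*} [NormedAddCommGroup V] [NormedSpace ℝ V]
    [NormedAddCommGroup W] [NormedSpace ℝ W]
    {f : E → V →L[ℝ] W} {z : E} (hf : ContDiffAt ℝ ∞ f z) (v : V) :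
    ContDiffAt ℝ ∞ (fun q : E × V ↦ (fderiv ℝ f q.1).flip q.2) (z, v) :=
  (contDiffAt_flip ((hf.fderiv_right (m := ∞) le_rfl).comp (z, v) contDiffAt_fst)).clm_apply
    contDiffAt_snd

set_option synthInstance.maxHeartbeats 100000 in
theorem contDiffAt_christoffel [CompleteSpace E] {G : E → E →L[ℝ] E →L[ℝ] ℝ} {z : E}
    (hG : ContDiffAt ℝ ∞ G z) (hinv : (G z).IsInvertible) (v : E) :
    ContDiffAt ℝ ∞ (fun q : E × E ↦ christoffel G q.1 q.2) (z, v) := by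
  -- Inversion of operators is smooth near an invertible one because E is complete.
  have hI : ContDiffAt ℝ ∞ (fun q : E × E ↦ (G q.1).inverse) (z, v) := by
    obtain ⟨e, he⟩ := hinv
    have : ContDiffAt ℝ ∞ ContinuousLinearMap.inverse (G z) := he ▸ contDiffAt_map_inverse e
    exact this.comp (z, v) (hG.comp (z, v) contDiffAt_fst)
  have h1 := contDiffAt_fderiv_flip_apply hG v
  have h2 := contDiffAt_fderiv_apply hG v
  exact hI.clm_comp (((h1.add h2).sub (contDiffAt_flip h1)).const_smul (2⁻¹ : ℝ))

end Calculus

/-! ### Transition maps of M and of TM -/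

section Coordinates

variable {E : Type*} [NormedAddCommGroup E] [NormedSpace ℝ E]
  {M : Type*} [TopologicalSpace M] [ChartedSpace E M]

/-- The change of coordinates from the chart at `x₀` to the chart at `p`. -/
def transition (x₀ p : M) : E → E := chartAt E p ∘ (chartAt E x₀).symm

theorem contDiffAt_transition [IsManifold 𝓘(ℝ, E) ∞ M] {x₀ p : M} {z : E}
    (hz : z ∈ (chartAt E x₀).target) (hp : (chartAt E x₀).symm z ∈ (chartAt E p).source) :
    ContDiffAt ℝ ∞ (transition x₀ p) z := by
  have := contDiffWithinAt_ext_coord_change (I := 𝓘(ℝ, E)) (n := ∞) p x₀ (y := z)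
    (by simpa using ⟨hz, hp⟩)
  simpa [transition] using! this

variable [IsManifold 𝓘(ℝ, E) ∞ M]

theorem coordChange_eq_fderiv (x₀ p q : M) :
    (tangentBundleCore 𝓘(ℝ, E) M).coordChange (achart E x₀) (achart E p) q =
      fderiv ℝ (transition x₀ p) (chartAt E x₀ q) := by
  rw [tangentBundleCore_coordChange_achart]
  simp [transition]

theorem coordChange_comp_apply {i j k : atlas E M} {q : M} (hi : q ∈ i.1.source)
    (hj : q ∈ j.1.source) (hk : q ∈ k.1.source) (v : E) :
    (tangentBundleCore 𝓘(ℝ, E) M).coordChange j k q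
      ((tangentBundleCore 𝓘(ℝ, E) M).coordChange i j q v) =
      (tangentBundleCore 𝓘(ℝ, E) M).coordChange i k q v :=
  (tangentBundleCore 𝓘(ℝ, E) M).coordChange_comp i j k q ⟨⟨hi, hj⟩, hk⟩ v

theorem ofCoord_eq_coordChange {x₀ q : M} (hq : q ∈ (chartAt E x₀).source) :
    ofCoord x₀ q = (tangentBundleCore 𝓘(ℝ, E) M).coordChange (achart E x₀) (achart E q) q :=
  TangentBundle.symmL_trivializationAt_eq_core hq

theorem toCoord_eq_coordChange {x₀ q : M} (hq : q ∈ (chartAt E x₀).source) :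
    toCoord x₀ q = (tangentBundleCore 𝓘(ℝ, E) M).coordChange (achart E q) (achart E x₀) q :=
  TangentBundle.continuousLinearMapAt_trivializationAt_eq_core hq

theorem ofCoord_toCoord {x₀ q : M} (hq : q ∈ (chartAt E x₀).source)
    (v : TangentSpace 𝓘(ℝ, E) q) : ofCoord x₀ q (toCoord x₀ q v) = v :=
  (trivializationAt E (TangentSpace 𝓘(ℝ, E)) x₀).symmL_continuousLinearMapAt hq v

theorem toCoord_ofCoord {x₀ q : M} (hq : q ∈ (chartAt E x₀).source) (v : E) :
    toCoord x₀ q (ofCoord x₀ q v) = v :=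
  (trivializationAt E (TangentSpace 𝓘(ℝ, E)) x₀).continuousLinearMapAt_symmL hq v

theorem toCoord_self (x : M) (v : E) : toCoord x x v = v := by
  conv_rhs => rw [← toCoord_ofCoord (mem_chart_source E x) v, ofCoord_self]

/-- T_pM is modelled on E by the preferred chart at p, so passing from the chart at x₀ to T_pM is
differentiating the transition to that chart. -/
theorem ofCoord_eq_fderiv {x₀ p : M} (hp : p ∈ (chartAt E x₀).source) :
    ofCoord x₀ p = fderiv ℝ (transition x₀ p) (chartAt E x₀ p) :=
  (ofCoord_eq_coordChange hp).trans (coordChange_eq_fderiv x₀ p p)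

theorem ofCoord_fderiv_transition {x₀ p q : M} (hq₀ : q ∈ (chartAt E x₀).source)
    (hq : q ∈ (chartAt E p).source) (v : E) :
    ofCoord p q (fderiv ℝ (transition x₀ p) (chartAt E x₀ q) v) = ofCoord x₀ q v := by
  rw [← coordChange_eq_fderiv, ofCoord_eq_coordChange hq, ofCoord_eq_coordChange hq₀]
  exact coordChange_comp_apply hq₀ hq (mem_chart_source E q) v

theorem fibreCoord_eq_toCoord {x₀ : M} {t : TangentBundle 𝓘(ℝ, E) M}
    (ht : t.proj ∈ (chartAt E x₀).source) : fibreCoord x₀ t = toCoord x₀ t.proj t.2 :=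
  (DFunLike.congr_fun (F := E →L[ℝ] E) (toCoord_eq_coordChange ht) t.2).symm

theorem fibreCoord_self (t : TangentBundle 𝓘(ℝ, E) M) : fibreCoord t.proj t = (t.2 : E) :=
  (fibreCoord_eq_toCoord (mem_chart_source E t.proj)).trans (toCoord_self (E := E) t.proj t.2)

theorem fderiv_transition_fibreCoord {x₀ : M} {t : TangentBundle 𝓘(ℝ, E) M}
    (ht : t.proj ∈ (chartAt E x₀).source) :
    fderiv ℝ (transition x₀ t.proj) (chartAt E x₀ t.proj) (fibreCoord x₀ t) = (t.2 : E) := by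
  rw [← ofCoord_eq_fderiv ht, fibreCoord_eq_toCoord ht]
  exact ofCoord_toCoord ht t.2

theorem extChartAt_tangent_symm (t₀ : TangentBundle 𝓘(ℝ, E) M) {a : E × E}
    (ha : a.1 ∈ (chartAt E t₀.proj).target) :
    (extChartAt 𝓘(ℝ, E).tangent t₀).symm a =
      ⟨(chartAt E t₀.proj).symm a.1,
        ofCoord t₀.proj ((chartAt E t₀.proj).symm a.1) a.2⟩ := by
  have hq := (chartAt E t₀.proj).map_target ha
  rw [ofCoord_eq_coordChange hq]
  rfl

/-- Fibre coordinates transform by the differential of the transition map φ of the base; hence the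
transition map of TM is (x, y) ↦ (φ(x), Dφ(x) y). -/
theorem extChartAt_tangent_comp_symm (t₀ t : TangentBundle 𝓘(ℝ, E) M) {a : E × E}
    (ha : a.1 ∈ (chartAt E t₀.proj).target)
    (ha' : (chartAt E t₀.proj).symm a.1 ∈ (chartAt E t.proj).source) :
    extChartAt 𝓘(ℝ, E).tangent t ((extChartAt 𝓘(ℝ, E).tangent t₀).symm a) =
      (transition t₀.proj t.proj a.1, fderiv ℝ (transition t₀.proj t.proj) a.1 a.2) := by
  have hq := (chartAt E t₀.proj).map_target ha
  rw [extChartAt_tangent_symm t₀ ha]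
  refine Prod.ext rfl ?_
  change fibreCoord t.proj _ = _
  rw [fibreCoord_eq_toCoord ha']
  change toCoord _ _ (ofCoord _ _ a.2) = _
  rw [← ofCoord_fderiv_transition hq ha', toCoord_ofCoord ha', (chartAt E t₀.proj).right_inv ha]

/-- The inverse of the differential of the chart of `TM` at `t₀`, in the chart of `TM` at `t`. -/
theorem symmL_tangentBundle {t₀ t : TangentBundle 𝓘(ℝ, E) M}
    (ht : t.proj ∈ (chartAt E t₀.proj).source) (a : E × E) :
    (trivializationAt (E × E) (TangentSpace 𝓘(ℝ, E).tangent) t₀).symmL ℝ t a =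
      (fderiv ℝ (transition t₀.proj t.proj) (chartAt E t₀.proj t.proj) a.1,
        fderiv ℝ (fderiv ℝ (transition t₀.proj t.proj)) (chartAt E t₀.proj t.proj) a.1
            (fibreCoord t₀.proj t) +
          fderiv ℝ (transition t₀.proj t.proj) (chartAt E t₀.proj t.proj) a.2) := by
  set φ : E → E := transition t₀.proj t.proj
  set z : E := chartAt E t₀.proj t.proj
  have hz : z ∈ (chartAt E t₀.proj).target := (chartAt E t₀.proj).map_source ht
  have hzp : (chartAt E t₀.proj).symm z = t.proj := (chartAt E t₀.proj).left_inv ht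
  have hφ : ContDiffAt ℝ ∞ φ z := contDiffAt_transition hz (hzp ▸ mem_chart_source E t.proj)
  have ht' : t ∈ (chartAt (ModelProd E E) t₀).source := by simpa using ht
  rw [TangentBundle.symmL_trivializationAt_eq_core ht', tangentBundleCore_coordChange_achart]
  have hr : Set.range (𝓘(ℝ, E).tangent : ModelProd E E → E × E) = Set.univ :=
    ModelWithCorners.range_eq_univ _
  rw [hr, fderivWithin_univ]
  have hpt : extChartAt 𝓘(ℝ, E).tangent t₀ t = (z, fibreCoord t₀.proj t) := rfl
  rw [hpt]
  have h1 : HasFDerivAt φ (fderiv ℝ φ z) z :=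
    (hφ.differentiableAt (by simp)).hasFDerivAt
  have h2 : HasFDerivAt (fderiv ℝ φ) (fderiv ℝ (fderiv ℝ φ) z) z :=
    ((hφ.fderiv_right (m := 1) (by norm_cast)).differentiableAt one_ne_zero).hasFDerivAt
  have hfst : HasFDerivAt Prod.fst (ContinuousLinearMap.fst ℝ E E) (z, fibreCoord t₀.proj t) :=
    hasFDerivAt_fst
  -- The product rule applied to (x, y) ↦ (φ(x), Dφ(x) y) produces the term with D²φ.
  have h3 := (HasFDerivAt.comp (g := φ) (z, fibreCoord t₀.proj t) h1 hfst).prodMk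
    ((HasFDerivAt.comp (g := fderiv ℝ φ) (z, fibreCoord t₀.proj t) h2 hfst).clm_apply
      hasFDerivAt_snd)
  have hnhds : ∀ᶠ b : E × E in nhds (z, fibreCoord t₀.proj t),
      b.1 ∈ (chartAt E t₀.proj).target ∧
        (chartAt E t₀.proj).symm b.1 ∈ (chartAt E t.proj).source := by
    refine continuousAt_fst.eventually (p := fun b : E ↦ b ∈ (chartAt E t₀.proj).target ∧
      (chartAt E t₀.proj).symm b ∈ (chartAt E t.proj).source) ?_
    exact ((chartAt E t₀.proj).open_target.eventually_mem hz).and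
      (((chartAt E t₀.proj).continuousAt_symm hz).eventually
        ((chartAt E t.proj).open_source.eventually_mem (hzp ▸ mem_chart_source E t.proj)))
  have h4 := h3.congr_of_eventuallyEq
    (f₁ := extChartAt 𝓘(ℝ, E).tangent t ∘ (extChartAt 𝓘(ℝ, E).tangent t₀).symm)
    (hnhds.mono fun b hb ↦ extChartAt_tangent_comp_symm t₀ t hb.1 hb.2)
  rw [h4.fderiv]
  exact Prod.ext rfl (add_comm (G := E) _ _)

end Coordinates

/-! ### Smoothness of tensor fields in local coordinates -/

section SmoothSections

variable {E : Type*} [NormedAddCommGroup E] [NormedSpace ℝ E]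
  {H : Type*} [TopologicalSpace H] (I : ModelWithCorners ℝ E H)
  {M : Type*} [TopologicalSpace M] [ChartedSpace H M] [IsManifold I ∞ M]

/-- The matrix of a field of endomorphisms in the chart at `x₀`. -/
def endInCoord (A : ∀ x : M, TangentSpace I x →L[ℝ] TangentSpace I x) (x₀ x : M) : E →L[ℝ] E :=
  (trivializationAt E (TangentSpace I) x₀).continuousLinearMapAt ℝ x ∘L A x ∘L
    (trivializationAt E (TangentSpace I) x₀).symmL ℝ x

/-- The matrix of a field of bilinear forms in the chart at `x₀`. -/
def formInCoord (g : ∀ x : M, TangentSpace I x →L[ℝ] TangentSpace I x →L[ℝ] ℝ) (x₀ x : M) :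
    E →L[ℝ] E →L[ℝ] ℝ :=
  pullbackForm (g x) ((trivializationAt E (TangentSpace I) x₀).symmL ℝ x)

theorem isTensorField11_iff (A : ∀ x : M, TangentSpace I x →L[ℝ] TangentSpace I x) :
    IsTensorField11 I A ↔
      ∀ x₀ : M, ContMDiffAt I 𝓘(ℝ, E →L[ℝ] E) ∞ (endInCoord I A x₀) x₀ := by
  refine forall_congr' fun x₀ ↦ ?_
  rw [contMDiffAt_hom_bundle]
  exact and_iff_right contMDiffAt_id

theorem contMDiff_form_iff (g : ∀ x : M, TangentSpace I x →L[ℝ] TangentSpace I x →L[ℝ] ℝ) :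
    ContMDiff I (I.prod 𝓘(ℝ, E →L[ℝ] E →L[ℝ] ℝ)) ∞
      (fun x ↦ Bundle.TotalSpace.mk' (E →L[ℝ] E →L[ℝ] ℝ)
        (E := fun x : M ↦ TangentSpace I x →L[ℝ] TangentSpace I x →L[ℝ] ℝ) x (g x)) ↔
      ∀ x₀ : M, ContMDiffAt I 𝓘(ℝ, E →L[ℝ] E →L[ℝ] ℝ) ∞ (formInCoord I g x₀) x₀ := by
  refine forall_congr' fun x₀ ↦ ?_
  rw [contMDiffAt_hom_bundle]
  refine (and_iff_right contMDiffAt_id).trans ?_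
  -- The two coordinate expressions need agree only near x₀, on the base set of the trivialization.
  refine Filter.EventuallyEq.contMDiffAt_iff ?_
  filter_upwards [(trivializationAt E (TangentSpace I) x₀).open_baseSet.mem_nhds
    (FiberBundle.mem_baseSet_trivializationAt' x₀)] with x hx
  ext v w
  refine (inCoordinates_apply_eq₂ hx hx (Set.mem_univ _)).trans ?_
  simp [formInCoord, pullbackForm_apply, Bundle.Trivialization.symmL_apply _ hx]

theorem isTensorField11_id :
    IsTensorField11 I (fun x : M ↦ ContinuousLinearMap.id ℝ (TangentSpace I x)) := by
  rw [isTensorField11_iff]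
  intro x₀
  refine (contMDiffAt_const (c := ContinuousLinearMap.id ℝ E)).congr_of_eventuallyEq ?_
  filter_upwards [(trivializationAt E (TangentSpace I) x₀).open_baseSet.mem_nhds
    (FiberBundle.mem_baseSet_trivializationAt' x₀)] with x hx
  ext v
  exact (trivializationAt E (TangentSpace I) x₀).continuousLinearMapAt_symmL hx v

theorem isTensorField11_zero :
    IsTensorField11 I (fun x : M ↦ (0 : TangentSpace I x →L[ℝ] TangentSpace I x)) := by
  rw [isTensorField11_iff]
  intro x₀
  have h : endInCoord I (fun x : M ↦ (0 : TangentSpace I x →L[ℝ] TangentSpace I x)) x₀ =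
      fun _ ↦ 0 := by
    ext x v
    exact ((trivializationAt E (TangentSpace I) x₀).continuousLinearMapAt ℝ x).map_zero
  rw [h]
  exact contMDiffAt_const

theorem IsTensorField11.neg {A : ∀ x : M, TangentSpace I x →L[ℝ] TangentSpace I x}
    (hA : IsTensorField11 I A) : IsTensorField11 I (fun x ↦ -A x) := by
  rw [isTensorField11_iff] at hA ⊢
  intro x₀
  have h : endInCoord I (fun x ↦ -A x) x₀ = fun x ↦ -endInCoord I A x₀ x := by
    ext x v
    exact ((trivializationAt E (TangentSpace I) x₀).continuousLinearMapAt ℝ x).map_neg _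
  rw [h]
  exact contDiff_neg.contMDiff.contMDiffAt.comp x₀ (hA x₀)

end SmoothSections

/-! ### The connection map in a fixed chart -/

section ConnectionMap

variable {E : Type*} [NormedAddCommGroup E] [NormedSpace ℝ E]
  {M : Type*} [TopologicalSpace M] [ChartedSpace E M] [IsManifold 𝓘(ℝ, E) ∞ M]
  {g : ∀ x : M, TangentSpace 𝓘(ℝ, E) x →L[ℝ] TangentSpace 𝓘(ℝ, E) x →L[ℝ] ℝ}

theorem contDiffAt_metricInChart (hg : IsSemiRiemannianMetric 𝓘(ℝ, E) g) (x₀ : M) :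
    ContDiffAt ℝ ∞ (metricInChart g x₀) (chartAt E x₀ x₀) := by
  have h1 := (contMDiff_form_iff 𝓘(ℝ, E) g).1 hg.smooth x₀
  have h2 : ContMDiffAt 𝓘(ℝ, E) 𝓘(ℝ, E) ∞ (chartAt E x₀).symm (chartAt E x₀ x₀) :=
    (contMDiffOn_chart_symm (I := 𝓘(ℝ, E)) (x := x₀)).contMDiffAt
      ((chartAt E x₀).open_target.mem_nhds (mem_chart_target E x₀))
  rw [← (chartAt E x₀).left_inv (mem_chart_source E x₀)] at h1
  exact contMDiffAt_iff_contDiffAt.1 ((show ContMDiffAt _ _ _ (formInCoord 𝓘(ℝ, E) g x₀)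
    ((chartAt E x₀).symm (chartAt E x₀ x₀)) from by simpa using h1).comp _ h2)

theorem isInvertible_metricInChart [FiniteDimensional ℝ E]
    (hg : IsSemiRiemannianMetric 𝓘(ℝ, E) g) {x₀ : M} {z : E}
    (hz : z ∈ (chartAt E x₀).target) : (metricInChart g x₀ z).IsInvertible := by
  have hq := (chartAt E x₀).map_target hz
  refine isInvertible_of_nondegenerate fun v hv ↦ ?_
  have h : ofCoord x₀ ((chartAt E x₀).symm z) v = 0 := by
    refine hg.nondegenerate _ _ fun w ↦ ?_
    rw [← ofCoord_toCoord hq w]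
    exact hv _
  rw [← toCoord_ofCoord hq v, h, map_zero]

theorem metricInChart_eq_pullbackForm {x₀ p : M} {z : E}
    (hz : z ∈ (chartAt E x₀).target) (hp : (chartAt E x₀).symm z ∈ (chartAt E p).source) :
    metricInChart g x₀ z =
      pullbackForm (metricInChart g p (transition x₀ p z)) (fderiv ℝ (transition x₀ p) z) := by
  have hq := (chartAt E x₀).map_target hz
  have hs : (chartAt E p).symm (transition x₀ p z) = (chartAt E x₀).symm z :=
    (chartAt E p).left_inv hp
  have h (v : E) : ofCoord p ((chartAt E x₀).symm z) (fderiv ℝ (transition x₀ p) z v) =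
      ofCoord x₀ ((chartAt E x₀).symm z) v := by
    rw [← ofCoord_fderiv_transition hq hp, (chartAt E x₀).right_inv hz]
  -- The base point is a variable q here because the tangent space depends on it: the equality of
  -- points can be substituted, but not rewritten in place.
  have hgs (v w : E) {q : M} (hqs : q = (chartAt E x₀).symm z) :
      g q (ofCoord p q (fderiv ℝ (transition x₀ p) z v))
        (ofCoord p q (fderiv ℝ (transition x₀ p) z w)) =
      g ((chartAt E x₀).symm z) (ofCoord x₀ ((chartAt E x₀).symm z) v)
        (ofCoord x₀ ((chartAt E x₀).symm z) w) := by
    subst hqs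
    rw [h, h]
  ext v w
  exact (hgs v w hs).symm

/-- In the chart centred at π(t) the coordinate isomorphisms at π(t) are the identity. -/
theorem connectionMap_apply (t : TangentBundle 𝓘(ℝ, E) M) (A : E × E) :
    connectionMap g t A = A.2 + christoffel (metricInChart g t.proj)
      (chartAt E t.proj t.proj) t.2 A.1 := by
  refine (ofCoord_self t.proj _).trans ?_
  rw [← fibreCoord_self t]
  refine (congr($(fibreCoord_mvfderiv_self t A) + christoffel (metricInChart g t.proj)
    (chartAt E t.proj t.proj) (fibreCoord t.proj t)
      (toCoord t.proj t.proj $(projDiff_apply t A)))).trans ?_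
  rw [toCoord_self]

theorem projDiff_symmL {t₀ t : TangentBundle 𝓘(ℝ, E) M}
    (ht : t.proj ∈ (chartAt E t₀.proj).source) (a : E × E) :
    projDiff t ((trivializationAt (E × E) (TangentSpace 𝓘(ℝ, E).tangent) t₀).symmL ℝ t a) =
      ofCoord t₀.proj t.proj a.1 := by
  rw [ofCoord_eq_fderiv ht]
  refine (projDiff_apply t _).trans ?_
  exact congrArg Prod.fst (symmL_tangentBundle ht a)

/-- The local expression of the connection map in the chart of `TM` at an arbitrary point. -/
theorem connectionMap_symmL [FiniteDimensional ℝ E] (hg : IsSemiRiemannianMetric 𝓘(ℝ, E) g)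
    {t₀ t : TangentBundle 𝓘(ℝ, E) M} (ht : t.proj ∈ (chartAt E t₀.proj).source) (a : E × E) :
    connectionMap g t ((trivializationAt (E × E) (TangentSpace 𝓘(ℝ, E).tangent) t₀).symmL ℝ t a) =
      ofCoord t₀.proj t.proj (a.2 + christoffel (metricInChart g t₀.proj)
        (chartAt E t₀.proj t.proj) (fibreCoord t₀.proj t) a.1) := by
  have hz : chartAt E t₀.proj t.proj ∈ (chartAt E t₀.proj).target :=
    (chartAt E t₀.proj).map_source ht
  have hzp : (chartAt E t₀.proj).symm (chartAt E t₀.proj t.proj) = t.proj :=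
    (chartAt E t₀.proj).left_inv ht
  have hp : (chartAt E t₀.proj).symm (chartAt E t₀.proj t.proj) ∈ (chartAt E t.proj).source :=
    hzp.symm ▸ mem_chart_source E t.proj
  have hφz : transition t₀.proj t.proj (chartAt E t₀.proj t.proj) = chartAt E t.proj t.proj :=
    congrArg (chartAt E t.proj) hzp
  have hφ := contDiffAt_transition hz hp
  -- The transition map φ carries the metric coefficients of one chart to those of the other, so the
  -- transformation law gives Dφ(Γ(a₁, y)) = Γ'(Dφ a₁, Dφ y) + D²φ(a₁, y).
  have key := christoffel_pullback (G := metricInChart g t₀.proj) (G' := metricInChart g t.proj)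
    (hφ.of_le (by norm_cast))
    (hφz ▸ (contDiffAt_metricInChart hg t.proj).of_le (by norm_cast))
    (((chartAt E t₀.proj).open_target.eventually_mem hz).and
      (((chartAt E t₀.proj).continuousAt_symm hz).eventually
        ((chartAt E t.proj).open_source.eventually_mem hp)) |>.mono
      fun z h ↦ metricInChart_eq_pullbackForm h.1 h.2)
    (isInvertible_metricInChart hg hz)
    (hφz ▸ isInvertible_metricInChart hg (mem_chart_target E t.proj))
    (fun v w ↦ hg.symm _ _ _)
    (fun w ↦ ⟨toCoord t₀.proj t.proj w, by
      rw [← ofCoord_eq_fderiv ht]; exact ofCoord_toCoord ht w⟩)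
    a.1 (fibreCoord t₀.proj t)
  rw [fderiv_transition_fibreCoord ht, hφz] at key
  rw [symmL_tangentBundle ht]
  refine (connectionMap_apply t _).trans ?_
  rw [ofCoord_eq_fderiv ht]
  refine Eq.trans ?_ (map_add _ _ _).symm
  refine Eq.trans ?_ (congrArg (fun v : E ↦
    fderiv ℝ (transition t₀.proj t.proj) (chartAt E t₀.proj t.proj) a.2 + v) key).symm
  -- Only a reordering remains: D²φ(a₁, y) from the tangent coordinates of TM matches the
  -- inhomogeneous term of `key`.
  have hadd (u v w : E) : u + v + w = v + (w + u) := by abel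
  exact hadd _ _ _

theorem contMDiffAt_proj (t₀ : TangentBundle 𝓘(ℝ, E) M) :
    ContMDiffAt 𝓘(ℝ, E).tangent 𝓘(ℝ, E) ∞ (fun t : TangentBundle 𝓘(ℝ, E) M ↦ t.proj) t₀ :=
  Bundle.contMDiff_proj (TangentSpace 𝓘(ℝ, E) (M := M)) t₀

theorem eventually_proj_mem_source (t₀ : TangentBundle 𝓘(ℝ, E) M) :
    ∀ᶠ t : TangentBundle 𝓘(ℝ, E) M in nhds t₀, t.proj ∈ (chartAt E t₀.proj).source :=
  (contMDiffAt_proj t₀).continuousAt.eventually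
    ((chartAt E t₀.proj).open_source.eventually_mem (mem_chart_source E t₀.proj))

end ConnectionMap

/-! ### Endomorphisms in the horizontal–vertical splitting -/

section BlockEndomorphisms

variable {E : Type*} [NormedAddCommGroup E] [NormedSpace ℝ E]
  {M : Type*} [TopologicalSpace M] [ChartedSpace E M] [IsManifold 𝓘(ℝ, E) ∞ M]
  (g : ∀ x : M, TangentSpace 𝓘(ℝ, E) x →L[ℝ] TangentSpace 𝓘(ℝ, E) x →L[ℝ] ℝ)

theorem ext_projDiff_connectionMap {t : TangentBundle 𝓘(ℝ, E) M}
    {A B : TangentSpace 𝓘(ℝ, E).tangent t} (h₁ : projDiff t A = projDiff t B)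
    (h₂ : connectionMap g t A = connectionMap g t B) : A = B :=
  (bijective_projDiff_connectionMap g t).1 (Prod.ext h₁ h₂)

theorem exists_lift (t : TangentBundle 𝓘(ℝ, E) M) (v w : TangentSpace 𝓘(ℝ, E) t.proj) :
    ∃ A : TangentSpace 𝓘(ℝ, E).tangent t, projDiff t A = v ∧ connectionMap g t A = w :=
  (existsUnique_lift g t v w).exists

/-- The inverse of `(π_*, K) : T_t(TM) → T_{π(t)}M × T_{π(t)}M`. -/
def lift (t : TangentBundle 𝓘(ℝ, E) M) :
    TangentSpace 𝓘(ℝ, E) t.proj × TangentSpace 𝓘(ℝ, E) t.proj →ₗ[ℝ]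
      TangentSpace 𝓘(ℝ, E).tangent t :=
  (LinearEquiv.ofBijective ((projDiff t).prod (connectionMap g t)).toLinearMap
    (bijective_projDiff_connectionMap g t)).symm.toLinearMap

theorem lift_spec (t : TangentBundle 𝓘(ℝ, E) M)
    (q : TangentSpace 𝓘(ℝ, E) t.proj × TangentSpace 𝓘(ℝ, E) t.proj) :
    (projDiff t (lift g t q), connectionMap g t (lift g t q)) = q :=
  (LinearEquiv.ofBijective ((projDiff t).prod (connectionMap g t)).toLinearMap
    (bijective_projDiff_connectionMap g t)).apply_symm_apply q

variable [FiniteDimensional ℝ E]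

/-- The field of endomorphisms of `T(TM)` with blocks `α, β, γ, δ` in the decomposition of
`T(TM)` into horizontal and vertical vectors. -/
def blockEndo (α β γ δ : ∀ x : M, TangentSpace 𝓘(ℝ, E) x →L[ℝ] TangentSpace 𝓘(ℝ, E) x)
    (t : TangentBundle 𝓘(ℝ, E) M) :
    TangentSpace 𝓘(ℝ, E).tangent t →L[ℝ] TangentSpace 𝓘(ℝ, E).tangent t :=
  haveI : FiniteDimensional ℝ (TangentSpace 𝓘(ℝ, E) t.proj) :=
    inferInstanceAs (FiniteDimensional ℝ E)
  haveI : T2Space (TangentSpace 𝓘(ℝ, E) t.proj) := inferInstanceAs (T2Space E)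
  LinearMap.toContinuousLinearMap (lift g t) ∘L
    (α t.proj ∘L projDiff t + β t.proj ∘L connectionMap g t).prod
      (γ t.proj ∘L projDiff t + δ t.proj ∘L connectionMap g t)

variable (α β γ δ : ∀ x : M, TangentSpace 𝓘(ℝ, E) x →L[ℝ] TangentSpace 𝓘(ℝ, E) x)
  {t : TangentBundle 𝓘(ℝ, E) M}

theorem projDiff_blockEndo (A : TangentSpace 𝓘(ℝ, E).tangent t) :
    projDiff t (blockEndo g α β γ δ t A) =
      α t.proj (projDiff t A) + β t.proj (connectionMap g t A) :=
  congrArg Prod.fst (lift_spec g t _)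

theorem connectionMap_blockEndo (A : TangentSpace 𝓘(ℝ, E).tangent t) :
    connectionMap g t (blockEndo g α β γ δ t A) =
      γ t.proj (projDiff t A) + δ t.proj (connectionMap g t A) :=
  congrArg Prod.snd (lift_spec g t _)

end BlockEndomorphisms

/-! ### Shears and block matrices on E × E -/

section LocalExpressions

variable {E : Type*} [NormedAddCommGroup E] [NormedSpace ℝ E]

/-- The map `(a, b) ↦ (a, b + C a)`. -/
def shear (C : E →L[ℝ] E) : E × E →L[ℝ] E × E :=
  ContinuousLinearMap.id ℝ (E × E) +
    ContinuousLinearMap.inr ℝ E E ∘L C ∘L ContinuousLinearMap.fst ℝ E E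

theorem shear_apply (C : E →L[ℝ] E) (a : E × E) : shear C a = (a.1, a.2 + C a.1) := by
  ext <;> simp [shear]

/-- The endomorphism of `E × E` with the blocks `α, β, γ, δ`. -/
def block (α β γ δ : E →L[ℝ] E) : E × E →L[ℝ] E × E :=
  ContinuousLinearMap.inl ℝ E E ∘L
      (α ∘L ContinuousLinearMap.fst ℝ E E + β ∘L ContinuousLinearMap.snd ℝ E E) +
    ContinuousLinearMap.inr ℝ E E ∘L
      (γ ∘L ContinuousLinearMap.fst ℝ E E + δ ∘L ContinuousLinearMap.snd ℝ E E)

theorem block_apply (α β γ δ : E →L[ℝ] E) (a : E × E) :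
    block α β γ δ a = (α a.1 + β a.2, γ a.1 + δ a.2) := by
  ext <;> simp [block]

variable {X : Type*} [NormedAddCommGroup X] [NormedSpace ℝ X]

theorem contDiff_shear {n : WithTop ℕ∞} : ContDiff ℝ n (shear : (E →L[ℝ] E) → _) :=
  contDiff_const.add (contDiff_const.clm_comp (contDiff_id.clm_comp contDiff_const))

theorem contDiff_block {n : WithTop ℕ∞} {α β γ δ : X → E →L[ℝ] E} (hα : ContDiff ℝ n α)
    (hβ : ContDiff ℝ n β) (hγ : ContDiff ℝ n γ) (hδ : ContDiff ℝ n δ) :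
    ContDiff ℝ n (fun x ↦ block (α x) (β x) (γ x) (δ x)) :=
  (contDiff_const.clm_comp ((hα.clm_comp contDiff_const).add (hβ.clm_comp contDiff_const))).add
    (contDiff_const.clm_comp ((hγ.clm_comp contDiff_const).add (hδ.clm_comp contDiff_const)))

end LocalExpressions

/-! ### Smoothness of block endomorphisms and of the Sasaki metric -/

section Smoothness

variable {E : Type*} [NormedAddCommGroup E] [NormedSpace ℝ E] [FiniteDimensional ℝ E]
  {M : Type*} [TopologicalSpace M] [ChartedSpace E M] [IsManifold 𝓘(ℝ, E) ∞ M]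
  {g : ∀ x : M, TangentSpace 𝓘(ℝ, E) x →L[ℝ] TangentSpace 𝓘(ℝ, E) x →L[ℝ] ℝ}

/-- The Christoffel symbols contracted with the fibre coordinate of a point of `TM`, in the chart
at `x₀`. -/
def christoffelAt (g : ∀ x : M, TangentSpace 𝓘(ℝ, E) x →L[ℝ] TangentSpace 𝓘(ℝ, E) x →L[ℝ] ℝ)
    (x₀ : M) (t : TangentBundle 𝓘(ℝ, E) M) : E →L[ℝ] E :=
  christoffel (metricInChart g x₀) (chartAt E x₀ t.proj) (fibreCoord x₀ t)

theorem contMDiffAt_christoffelAt (hg : IsSemiRiemannianMetric 𝓘(ℝ, E) g)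
    (t₀ : TangentBundle 𝓘(ℝ, E) M) :
    ContMDiffAt 𝓘(ℝ, E).tangent 𝓘(ℝ, E →L[ℝ] E) ∞ (christoffelAt g t₀.proj) t₀ := by
  have : CompleteSpace E := FiniteDimensional.complete ℝ E
  have h1 := contDiffAt_christoffel (contDiffAt_metricInChart hg t₀.proj)
    (isInvertible_metricInChart hg (mem_chart_target E t₀.proj)) (fibreCoord t₀.proj t₀)
  -- Base and fibre coordinates together form the chart of TM at t₀, so joint smoothness of Γ in (x,
  -- y) is what is needed.
  have h2 : ContMDiffAt 𝓘(ℝ, E).tangent 𝓘(ℝ, E × E) ∞ (extChartAt 𝓘(ℝ, E).tangent t₀) t₀ :=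
    contMDiffAt_extChartAt
  exact h1.contMDiffAt.comp t₀ h2

variable {α β γ δ : ∀ x : M, TangentSpace 𝓘(ℝ, E) x →L[ℝ] TangentSpace 𝓘(ℝ, E) x}

/-- The shear by C turns chart coordinates into the components (π_*, K), where the endomorphism is a
block matrix; the shear by -C returns to chart coordinates. -/
theorem blockEndo_symmL (hg : IsSemiRiemannianMetric 𝓘(ℝ, E) g)
    {t₀ t : TangentBundle 𝓘(ℝ, E) M} (ht : t.proj ∈ (chartAt E t₀.proj).source) (a : E × E) :
    blockEndo g α β γ δ t
        ((trivializationAt (E × E) (TangentSpace 𝓘(ℝ, E).tangent) t₀).symmL ℝ t a) =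
      (trivializationAt (E × E) (TangentSpace 𝓘(ℝ, E).tangent) t₀).symmL ℝ t
        ((shear (-christoffelAt g t₀.proj t) ∘L
          block (endInCoord 𝓘(ℝ, E) α t₀.proj t.proj) (endInCoord 𝓘(ℝ, E) β t₀.proj t.proj)
            (endInCoord 𝓘(ℝ, E) γ t₀.proj t.proj) (endInCoord 𝓘(ℝ, E) δ t₀.proj t.proj) ∘L
          shear (christoffelAt g t₀.proj t)) a) := by
  have hend (ε : ∀ x : M, TangentSpace 𝓘(ℝ, E) x →L[ℝ] TangentSpace 𝓘(ℝ, E) x) (v : E) :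
      ofCoord t₀.proj t.proj (endInCoord 𝓘(ℝ, E) ε t₀.proj t.proj v) =
        ε t.proj (ofCoord t₀.proj t.proj v) := ofCoord_toCoord ht _
  simp only [ContinuousLinearMap.comp_apply, shear_apply, block_apply]
  refine ext_projDiff_connectionMap g ?_ ?_
  · rw [projDiff_blockEndo, projDiff_symmL ht, connectionMap_symmL hg ht, projDiff_symmL ht]
    simp only [map_add, hend, christoffelAt]
  · rw [connectionMap_blockEndo, projDiff_symmL ht, connectionMap_symmL hg ht,
      connectionMap_symmL hg ht]
    simp only [neg_apply, christoffelAt, neg_add_cancel_right]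
    simp only [map_add, hend]

theorem isTensorField11_blockEndo (hg : IsSemiRiemannianMetric 𝓘(ℝ, E) g)
    (hα : IsTensorField11 𝓘(ℝ, E) α) (hβ : IsTensorField11 𝓘(ℝ, E) β)
    (hγ : IsTensorField11 𝓘(ℝ, E) γ) (hδ : IsTensorField11 𝓘(ℝ, E) δ) :
    IsTensorField11 𝓘(ℝ, E).tangent (blockEndo g α β γ δ) := by
  rw [isTensorField11_iff] at hα hβ hγ hδ ⊢
  intro t₀
  have hp := contMDiffAt_proj t₀
  have hq := (contMDiffAt_christoffelAt hg t₀).prodMk_space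
    ((((hα t₀.proj).comp t₀ hp).prodMk_space ((hβ t₀.proj).comp t₀ hp)).prodMk_space
      (((hγ t₀.proj).comp t₀ hp).prodMk_space ((hδ t₀.proj).comp t₀ hp)))
  -- The local expression is one fixed smooth function of C and the four blocks, each of which
  -- depends smoothly on t.
  have hF : ContDiff ℝ ∞ (fun q : (E →L[ℝ] E) × ((E →L[ℝ] E) × (E →L[ℝ] E)) ×
      ((E →L[ℝ] E) × (E →L[ℝ] E)) ↦
      shear (-q.1) ∘L block q.2.1.1 q.2.1.2 q.2.2.1 q.2.2.2 ∘L shear q.1) :=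
    ((contDiff_shear (E := E)).comp contDiff_fst.neg).clm_comp
      ((contDiff_block contDiff_snd.fst.fst contDiff_snd.fst.snd contDiff_snd.snd.fst
        contDiff_snd.snd.snd).clm_comp ((contDiff_shear (E := E)).comp contDiff_fst))
  refine (hF.contMDiff.contMDiffAt.comp t₀ hq).congr_of_eventuallyEq ?_
  filter_upwards [eventually_proj_mem_source t₀] with t ht
  have ht' : t ∈ (trivializationAt (E × E) (TangentSpace 𝓘(ℝ, E).tangent) t₀).baseSet := by
    simpa using ht
  refine ContinuousLinearMap.ext fun a ↦ ?_
  refine (congrArg ((trivializationAt (E × E)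
    (TangentSpace 𝓘(ℝ, E).tangent) t₀).continuousLinearMapAt ℝ t) (blockEndo_symmL hg ht a)).trans ?_
  exact (trivializationAt (E × E) (TangentSpace 𝓘(ℝ, E).tangent) t₀).continuousLinearMapAt_symmL
    ht' _

theorem contMDiffAt_sasakiMetric (hg : IsSemiRiemannianMetric 𝓘(ℝ, E) g)
    (t₀ : TangentBundle 𝓘(ℝ, E) M) :
    ContMDiffAt 𝓘(ℝ, E).tangent 𝓘(ℝ, E × E →L[ℝ] E × E →L[ℝ] ℝ) ∞
      (formInCoord 𝓘(ℝ, E).tangent (sasakiMetric g) t₀) t₀ := by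
  have hp := contMDiffAt_proj t₀
  have hq := (((contMDiff_form_iff 𝓘(ℝ, E) g).1 hg.smooth t₀.proj).comp t₀ hp).prodMk_space
    (contMDiffAt_christoffelAt hg t₀)
  have hF : ContDiff ℝ ∞ (fun q : (E →L[ℝ] E →L[ℝ] ℝ) × (E →L[ℝ] E) ↦
      pullbackForm q.1 (ContinuousLinearMap.snd ℝ E E ∘L shear q.2) +
        pullbackForm q.1 (ContinuousLinearMap.fst ℝ E E)) := by
    rw [contDiff_iff_contDiffAt]
    intro q
    have hs : ContDiff ℝ ∞ (fun q : (E →L[ℝ] E →L[ℝ] ℝ) × (E →L[ℝ] E) ↦ shear q.2) :=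
      contDiff_shear.comp contDiff_snd
    exact (contDiffAt_pullbackForm contDiffAt_fst (contDiff_const.clm_comp hs).contDiffAt).add
      (contDiffAt_pullbackForm contDiffAt_fst contDiffAt_const)
  refine (hF.contMDiff.contMDiffAt.comp t₀ hq).congr_of_eventuallyEq ?_
  filter_upwards [eventually_proj_mem_source t₀] with t ht
  refine ContinuousLinearMap.ext fun a ↦ ContinuousLinearMap.ext fun b ↦ ?_
  have h := sasakiMetric_apply g t
    ((trivializationAt (E × E) (TangentSpace 𝓘(ℝ, E).tangent) t₀).symmL ℝ t a)
    ((trivializationAt (E × E) (TangentSpace 𝓘(ℝ, E).tangent) t₀).symmL ℝ t b)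
  rw [connectionMap_symmL hg ht, connectionMap_symmL hg ht, projDiff_symmL ht,
    projDiff_symmL ht] at h
  exact h

end Smoothness

/-! ### The Sasaki metric and the three structures on TM -/

section Structures

variable {E : Type*} [NormedAddCommGroup E] [NormedSpace ℝ E] [FiniteDimensional ℝ E]
  {M : Type*} [TopologicalSpace M] [ChartedSpace E M] [IsManifold 𝓘(ℝ, E) ∞ M]
  {g : ∀ x : M, TangentSpace 𝓘(ℝ, E) x →L[ℝ] TangentSpace 𝓘(ℝ, E) x →L[ℝ] ℝ}

theorem isSemiRiemannianMetric_sasakiMetric (hg : IsSemiRiemannianMetric 𝓘(ℝ, E) g) :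
    IsSemiRiemannianMetric 𝓘(ℝ, E).tangent (sasakiMetric g) where
  smooth := (contMDiff_form_iff 𝓘(ℝ, E).tangent (sasakiMetric g)).2 (contMDiffAt_sasakiMetric hg)
  symm t A B := by
    rw [sasakiMetric_apply, sasakiMetric_apply, hg.symm, hg.symm _ (projDiff t A)]
  nondegenerate t A hA := by
    refine ext_projDiff_connectionMap g ?_ ?_
    · rw [map_zero]
      refine hg.nondegenerate _ _ fun w ↦ ?_
      -- Pairing with a horizontal B isolates the π_* term; a vertical B below isolates the K term.
      obtain ⟨B, h₁, h₂⟩ := exists_lift g t w 0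
      have h := hA B
      rwa [sasakiMetric_apply, h₁, h₂, map_zero, zero_add] at h
    · rw [map_zero]
      refine hg.nondegenerate _ _ fun w ↦ ?_
      obtain ⟨B, h₁, h₂⟩ := exists_lift g t 0 w
      have h := hA B
      rwa [sasakiMetric_apply, h₁, h₂, map_zero, add_zero] at h

variable (g) in
/-- The almost complex structure `Xʰ ↦ Xᵛ`, `Xᵛ ↦ -Xʰ`. -/
def complexStructure : ∀ t : TangentBundle 𝓘(ℝ, E) M,
    TangentSpace 𝓘(ℝ, E).tangent t →L[ℝ] TangentSpace 𝓘(ℝ, E).tangent t :=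
  blockEndo g (fun _ ↦ 0) (fun x ↦ -ContinuousLinearMap.id ℝ (TangentSpace 𝓘(ℝ, E) x))
    (fun x ↦ ContinuousLinearMap.id ℝ (TangentSpace 𝓘(ℝ, E) x)) (fun _ ↦ 0)

variable (g) in
/-- The almost product structure `Xʰ ↦ (PX)ᵛ`, `Xᵛ ↦ (PX)ʰ`. -/
def swapStructure (P : ∀ x : M, TangentSpace 𝓘(ℝ, E) x →L[ℝ] TangentSpace 𝓘(ℝ, E) x) :
    ∀ t : TangentBundle 𝓘(ℝ, E) M,
      TangentSpace 𝓘(ℝ, E).tangent t →L[ℝ] TangentSpace 𝓘(ℝ, E).tangent t :=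
  blockEndo g (fun _ ↦ 0) P P (fun _ ↦ 0)

variable (g) in
/-- The almost product structure `Xʰ ↦ (PX)ʰ`, `Xᵛ ↦ -(PX)ᵛ`. -/
def diagStructure (P : ∀ x : M, TangentSpace 𝓘(ℝ, E) x →L[ℝ] TangentSpace 𝓘(ℝ, E) x) :
    ∀ t : TangentBundle 𝓘(ℝ, E) M,
      TangentSpace 𝓘(ℝ, E).tangent t →L[ℝ] TangentSpace 𝓘(ℝ, E).tangent t :=
  blockEndo g P (fun _ ↦ 0) (fun _ ↦ 0) (fun x ↦ -P x)

variable {P : ∀ x : M, TangentSpace 𝓘(ℝ, E) x →L[ℝ] TangentSpace 𝓘(ℝ, E) x}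
  {t : TangentBundle 𝓘(ℝ, E) M} (A : TangentSpace 𝓘(ℝ, E).tangent t)

theorem projDiff_complexStructure :
    projDiff t (complexStructure g t A) = -connectionMap g t A :=
  (projDiff_blockEndo g _ _ _ _ A).trans (zero_add _)

theorem connectionMap_complexStructure :
    connectionMap g t (complexStructure g t A) = projDiff t A :=
  (connectionMap_blockEndo g _ _ _ _ A).trans (add_zero _)

theorem projDiff_swapStructure :
    projDiff t (swapStructure g P t A) = P t.proj (connectionMap g t A) :=
  (projDiff_blockEndo g _ _ _ _ A).trans (zero_add _)

theorem connectionMap_swapStructure :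
    connectionMap g t (swapStructure g P t A) = P t.proj (projDiff t A) :=
  (connectionMap_blockEndo g _ _ _ _ A).trans (add_zero _)

theorem projDiff_diagStructure :
    projDiff t (diagStructure g P t A) = P t.proj (projDiff t A) :=
  (projDiff_blockEndo g _ _ _ _ A).trans (add_zero _)

theorem connectionMap_diagStructure :
    connectionMap g t (diagStructure g P t A) = -P t.proj (connectionMap g t A) :=
  (connectionMap_blockEndo g _ _ _ _ A).trans (zero_add _)

theorem isAlmostComplex_complexStructure (hg : IsSemiRiemannianMetric 𝓘(ℝ, E) g) :
    IsAlmostComplex 𝓘(ℝ, E).tangent (complexStructure g) where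
  smooth := isTensorField11_blockEndo hg (isTensorField11_zero _) (isTensorField11_id _).neg
    (isTensorField11_id _) (isTensorField11_zero _)
  sq t A := by
    refine ext_projDiff_connectionMap g ?_ ?_
    · rw [projDiff_complexStructure, connectionMap_complexStructure, map_neg]
    · rw [connectionMap_complexStructure, projDiff_complexStructure, map_neg]

theorem isAlmostProduct_swapStructure (hg : IsSemiRiemannianMetric 𝓘(ℝ, E) g)
    (hP : IsAlmostProduct 𝓘(ℝ, E) P) :
    IsAlmostProduct 𝓘(ℝ, E).tangent (swapStructure g P) where
  smooth := isTensorField11_blockEndo hg (isTensorField11_zero _) hP.smooth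
    hP.smooth (isTensorField11_zero _)
  ne_id h := by
    -- J₂ sends horizontal vectors to vertical ones. If J₂ were the identity, the lift of any v
    -- would have projection zero, so every tangent space of M would vanish and P would equal Id.
    -- The case of -Id ends in the same contradiction.
    refine hP.ne_id (funext fun x ↦ ContinuousLinearMap.ext fun v ↦ ?_)
    obtain ⟨A, h₁, h₂⟩ := exists_lift g (⟨x, 0⟩ : TangentBundle 𝓘(ℝ, E) M) v 0
    have h₃ := projDiff_swapStructure (g := g) (P := P) A
    rw [h, h₂, map_zero] at h₃
    have hv : v = 0 := h₁.symm.trans h₃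
    rw [hv, map_zero, map_zero]
  ne_neg_id h := by
    refine hP.ne_id (funext fun x ↦ ContinuousLinearMap.ext fun v ↦ ?_)
    obtain ⟨A, h₁, h₂⟩ := exists_lift g (⟨x, 0⟩ : TangentBundle 𝓘(ℝ, E) M) v 0
    have h₃ := projDiff_swapStructure (g := g) (P := P) A
    rw [h, h₂, map_zero] at h₃
    have hv : v = 0 := h₁.symm.trans (neg_eq_zero.1 ((map_neg (projDiff _) A).symm.trans h₃))
    rw [hv, map_zero, map_zero]
  sq t A := by
    refine ext_projDiff_connectionMap g ?_ ?_
    · rw [projDiff_swapStructure, connectionMap_swapStructure, hP.sq]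
    · rw [connectionMap_swapStructure, projDiff_swapStructure, hP.sq]

theorem isAlmostProduct_diagStructure (hg : IsSemiRiemannianMetric 𝓘(ℝ, E) g)
    (hP : IsAlmostProduct 𝓘(ℝ, E) P) :
    IsAlmostProduct 𝓘(ℝ, E).tangent (diagStructure g P) where
  smooth := isTensorField11_blockEndo hg hP.smooth (isTensorField11_zero _)
    (isTensorField11_zero _) hP.smooth.neg
  ne_id h := by
    -- On horizontal vectors J₃ acts as P, so J₃ = ±Id would force P = ±Id.
    refine hP.ne_id (funext fun x ↦ ContinuousLinearMap.ext fun v ↦ ?_)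
    obtain ⟨A, h₁, -⟩ := exists_lift g (⟨x, 0⟩ : TangentBundle 𝓘(ℝ, E) M) v 0
    have h₃ := projDiff_diagStructure (g := g) (P := P) A
    rw [h, h₁] at h₃
    exact h₃.symm.trans h₁
  ne_neg_id h := by
    refine hP.ne_neg_id (funext fun x ↦ ContinuousLinearMap.ext fun v ↦ ?_)
    obtain ⟨A, h₁, -⟩ := exists_lift g (⟨x, 0⟩ : TangentBundle 𝓘(ℝ, E) M) v 0
    have h₃ := projDiff_diagStructure (g := g) (P := P) A
    rw [h, h₁] at h₃
    exact h₃.symm.trans ((map_neg _ A).trans (congrArg Neg.neg h₁))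
  sq t A := by
    refine ext_projDiff_connectionMap g ?_ ?_
    · rw [projDiff_diagStructure, projDiff_diagStructure, hP.sq]
    · rw [connectionMap_diagStructure, connectionMap_diagStructure, map_neg, neg_neg, hP.sq]

theorem isAlmostParaHypercomplex_tangentBundle (hg : IsSemiRiemannianMetric 𝓘(ℝ, E) g)
    (hP : IsAlmostProduct 𝓘(ℝ, E) P) :
    IsAlmostParaHypercomplex 𝓘(ℝ, E).tangent (complexStructure g) (swapStructure g P)
      (diagStructure g P) where
  complex₁ := isAlmostComplex_complexStructure hg
  product₂ := isAlmostProduct_swapStructure hg hP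
  product₃ := isAlmostProduct_diagStructure hg hP
  mul₂₁ t A := by
    refine ext_projDiff_connectionMap g ?_ ?_
    · rw [projDiff_swapStructure, connectionMap_complexStructure, projDiff_diagStructure]
    · rw [connectionMap_swapStructure, projDiff_complexStructure, connectionMap_diagStructure,
        map_neg]
  mul₁₂ t A := by
    refine ext_projDiff_connectionMap g ?_ ?_
    · rw [map_neg, projDiff_complexStructure, connectionMap_swapStructure, projDiff_diagStructure,
        neg_neg]
    · rw [map_neg, connectionMap_complexStructure, projDiff_swapStructure,
        connectionMap_diagStructure]

theorem isParaHyperhermitian_sasakiMetric (hPg : IsAlmostParaHermitian 𝓘(ℝ, E) P g) :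
    IsParaHyperhermitian 𝓘(ℝ, E).tangent (complexStructure g) (swapStructure g P)
      (diagStructure g P) (sasakiMetric g) where
  metric := isSemiRiemannianMetric_sasakiMetric hPg.metric
  compat₁ t A B := by
    simp only [sasakiMetric_apply, projDiff_complexStructure, connectionMap_complexStructure,
      map_neg, neg_apply, neg_neg]
    ring
  compat₂ t A B := by
    simp only [sasakiMetric_apply, projDiff_swapStructure, connectionMap_swapStructure,
      hPg.compat]
    ring
  compat₃ t A B := by
    simp only [sasakiMetric_apply, projDiff_diagStructure, connectionMap_diagStructure,
      map_neg, neg_apply, neg_neg, hPg.compat]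
    ring

end Structures

end ParaHyperhermitian

end

theorem theorem3p2 {E : Type*} [NormedAddCommGroup E] [NormedSpace ℝ E] [FiniteDimensional ℝ E]
    {M : Type*} [TopologicalSpace M] [ChartedSpace E M] [IsManifold 𝓘(ℝ, E) ∞ M]
    (P : ∀ x : M, TangentSpace 𝓘(ℝ, E) x →L[ℝ] TangentSpace 𝓘(ℝ, E) x)
    (g : ∀ x : M, TangentSpace 𝓘(ℝ, E) x →L[ℝ] TangentSpace 𝓘(ℝ, E) x →L[ℝ] ℝ)
    (hPg : ParaHyperhermitian.IsAlmostParaHermitian 𝓘(ℝ, E) P g) :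
    ∃ J₁ J₂ J₃ : ∀ t : TangentBundle 𝓘(ℝ, E) M,
        TangentSpace 𝓘(ℝ, E).tangent t →L[ℝ] TangentSpace 𝓘(ℝ, E).tangent t,
      (∀ (X : ∀ x : M, TangentSpace 𝓘(ℝ, E) x) (t : TangentBundle 𝓘(ℝ, E) M),
        J₁ t (ParaHyperhermitian.horizontalLift g X t) =
          ParaHyperhermitian.verticalLift g X t ∧
        J₁ t (ParaHyperhermitian.verticalLift g X t) =
          -ParaHyperhermitian.horizontalLift g X t ∧
        J₂ t (ParaHyperhermitian.horizontalLift g X t) =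
          ParaHyperhermitian.verticalLift g (fun x ↦ P x (X x)) t ∧
        J₂ t (ParaHyperhermitian.verticalLift g X t) =
          ParaHyperhermitian.horizontalLift g (fun x ↦ P x (X x)) t ∧
        J₃ t (ParaHyperhermitian.horizontalLift g X t) =
          ParaHyperhermitian.horizontalLift g (fun x ↦ P x (X x)) t ∧
        J₃ t (ParaHyperhermitian.verticalLift g X t) =
          -ParaHyperhermitian.verticalLift g (fun x ↦ P x (X x)) t) ∧
      ParaHyperhermitian.IsAlmostParaHypercomplex 𝓘(ℝ, E).tangent J₁ J₂ J₃ ∧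
      ParaHyperhermitian.IsParaHyperhermitian 𝓘(ℝ, E).tangent J₁ J₂ J₃
        (ParaHyperhermitian.sasakiMetric g) := by
  open ParaHyperhermitian in
  refine ⟨complexStructure g, swapStructure g P, diagStructure g P, fun X t ↦ ?_,
    isAlmostParaHypercomplex_tangentBundle hPg.metric hPg.product,
    isParaHyperhermitian_sasakiMetric hPg⟩
  obtain ⟨hh₁, hh₂⟩ := horizontalLift_spec g X t
  obtain ⟨hv₁, hv₂⟩ := verticalLift_spec g X t
  obtain ⟨ph₁, ph₂⟩ := horizontalLift_spec g (fun x ↦ P x (X x)) t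
  obtain ⟨pv₁, pv₂⟩ := verticalLift_spec g (fun x ↦ P x (X x)) t
  -- Each of the six identities is compared in its π_* and K components, which the defining
  -- properties of the lifts determine.
  refine ⟨?_, ?_, ?_, ?_, ?_, ?_⟩ <;> refine ext_projDiff_connectionMap g ?_ ?_
  · rw [projDiff_complexStructure, hh₂, hv₁, neg_zero]
  · rw [connectionMap_complexStructure, hh₁, hv₂]
  · rw [projDiff_complexStructure, map_neg, hv₂, hh₁]
  · rw [connectionMap_complexStructure, map_neg, hv₁, hh₂, neg_zero]
  · rw [projDiff_swapStructure, hh₂, pv₁, map_zero]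
  · rw [connectionMap_swapStructure, hh₁, pv₂]
  · rw [projDiff_swapStructure, hv₂, ph₁]
  · rw [connectionMap_swapStructure, hv₁, ph₂, map_zero]
  · rw [projDiff_diagStructure, hh₁, ph₁]
  · rw [connectionMap_diagStructure, hh₂, ph₂, map_zero, neg_zero]
  · rw [projDiff_diagStructure, map_neg, hv₁, pv₁, map_zero, neg_zero]
  · rw [connectionMap_diagStructure, map_neg, hv₂, pv₂]
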